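/- **Proposition (Time stability).** Let $x_{\max},T,\epsilon>0$, $\Omega=(-x_{\max},x_{\max})\times(-1,1)$ with points $(x,v)$, $I=(0,T)$, and let $\Gamma_0^-=\big(\{-x_{\max}\}\times[0,1)\big)\cup\big(\{x_{\max}\}\times(-1,0]\big)\cup\big((-x_{\max},x_{\max})\times\{\pm1\}\big)$. Let $M=(M_{ij})\in\mathbb R^{2\times2}$ be symmetric and positive semidefinite with non-negative entries and $4\epsilon M_{12}>M_{22}^2$. For $w,\phi\in H^1(\Omega)$ put $\langle w,\phi\rangle_{\mathcal H}=\langle w,\phi\rangle_{L^2(\Omega)}+\langle\nabla w,M\nabla\phi\rangle_{L^2(\Omega)}$ and $\|w\|_{\mathcal H}^2=\langle w,w\rangle_{\mathcal H}$; for $w,\phi\in H^2(\Omega)$ put $$a(w,\phi)=\langle v w_x,\phi\rangle_{\mathcal H}+\epsilon\langle w_v,\phi_v\rangle_{\mathcal H}.$$ Let $H^2_{0,\Gamma_0^-}(\Omega)$ be the space of $w\in H^2(\Omega)$ such that $w=0$ and $\sqrt M\,\nabla w=0$ on $\Gamma_0^-$ in the sense of traces. Let $C_p\ge 0$ be any constant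 for which the Poincaré inequality $\|w\|_{L^2(\Omega)}\le C_p\|\nabla w\|_{L^2(\Omega)}$ holds for all $w\in H^1(\Omega)$ with $w=0$ on $\Gamma_0^-$ (for example the smallest such constant), and let $$\delta=\max\{1,\lambda_{\max}(M)\}^{-1}(1+C_p^2)^{-1}\lambda_{\min}(N),\qquad N=\begin{pmatrix}M_{12}&M_{22}/2\\ M_{22}/2&\epsilon\end{pmatrix}.$$ Let $f\in C(I;H^1(\Omega))$ with $\|f\|:=\sup_{t\in I}\|f(t)\|_{\mathcal H}<\infty$ (if $f\in C(\bar I;H^1(\Omega))$ this is $\|f\|_{C(\bar I;\mathcal H)}$), and let $u_0\in H^1(\Omega)$. Suppose that $u:\bar I\to H^1(\Omega)$ is continuous with respect to $\|\cdot\|_{\mathcal H}$, that its restriction to $I$ belongs to $C^1(I;H^2_{0,\Gamma_0^-}(\Omega))$ with $\|u(\cdot)\|_{\mathcal H}\in C^1(I)$, that $u(0)=u_0$, and that $u$ solves the hypocoercive weak form of $u_t+vu_x-\epsilon u_{vv}=f$: $$\langle u_t,\phi\rangle_{\mathcal H}+a(u,\phi)=\langle f,\phi\rangle_{\mathcal H}\qquad\text{for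 all }\phi\in H^2_{0,\Gamma_0^-}(\Omega)\text{ and a.e. }t\in I.$$ Put $$B(\tau)=e^{-\delta\tau}\|u_0\|_{\mathcal H}^2+\frac{1-e^{-\delta\tau}}{\delta^2}\,\|f\|^2 .$$ Then for every $\tau\in\bar I=[0,T]$ $$\|u(\tau)\|_{\mathcal H}^2\le B(\tau)\le\max\{B(0),B(T)\},$$ and in particular $\|u(\tau)\|_{\mathcal H}^2\le\max\{B(0),B(T)\}$. -/

import Mathlib

open Set Filter Topology MeasureTheory
open scoped ContDiff

noncomputable section

namespace Kolmogorov

/-! ### The domain and its boundary -/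

/-- The position-velocity domain `(-X, X) × (-1, 1)`; points are `(x, v)`. -/
def Omega (X : ℝ) : Set (ℝ × ℝ) := Ioo (-X) X ×ˢ Ioo (-1) 1

/-- The inflow boundary `{-X} × [0, 1) ∪ {X} × (-1, 0]`. -/
def inflow (X : ℝ) : Set (ℝ × ℝ) := ({-X} ×ˢ Ico 0 1) ∪ ({X} ×ˢ Ioc (-1) 0)

/-- The parabolic boundary `(-X, X) × {-1, 1}`. -/
def parabolicBdry (X : ℝ) : Set (ℝ × ℝ) := Ioo (-X) X ×ˢ {-1, 1}

/-- The part of the boundary that carries the Dirichlet condition. -/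
def dirichletBdry (X : ℝ) : Set (ℝ × ℝ) := inflow X ∪ parabolicBdry X

/-- The surface measure on the boundary of the rectangle: arc length on each of the four sides. -/
def bdryMeasure (X : ℝ) : Measure (ℝ × ℝ) :=
  (volume.restrict (Icc (-1 : ℝ) 1)).map (fun v => (-X, v)) +
  (volume.restrict (Icc (-1 : ℝ) 1)).map (fun v => (X, v)) +
  (volume.restrict (Icc (-X) X)).map (fun x => (x, (-1 : ℝ))) +
  (volume.restrict (Icc (-X) X)).map (fun x => (x, (1 : ℝ)))

/-! ### Classical derivatives and test functions -/

/-- The classical partial derivative in `x`. -/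
def pdx (φ : ℝ × ℝ → ℝ) : ℝ × ℝ → ℝ := fun p => fderiv ℝ φ p (1, 0)

/-- The classical partial derivative in `v`. -/
def pdv (φ : ℝ × ℝ → ℝ) : ℝ × ℝ → ℝ := fun p => fderiv ℝ φ p (0, 1)

/-- Smooth functions with compact support in the domain. -/
structure IsTest (X : ℝ) (φ : ℝ × ℝ → ℝ) : Prop where
  smooth : ContDiff ℝ ∞ φ
  compact : HasCompactSupport φ
  supp : tsupport φ ⊆ Omega X

/-- The space `L²(Ω)`. -/
abbrev L2 (X : ℝ) : Type := Lp ℝ 2 (volume.restrict (Omega X))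

/-- `g` is the weak derivative `∂ₓ^i ∂ᵥ^j w` on the domain. -/
def IsWeakDeriv (X : ℝ) (i j : ℕ) (w g : L2 X) : Prop :=
  ∀ φ : ℝ × ℝ → ℝ, IsTest X φ →
    ∫ p in Omega X, w p * (pdx^[i] (pdv^[j] φ)) p =
      (-1) ^ (i + j) * ∫ p in Omega X, g p * φ p

lemma pdx_eq_pdv_comm {φ : ℝ × ℝ → ℝ} (h : ContDiff ℝ ∞ φ) : pdv (pdx φ) = pdx (pdv φ) := by
  funext p
  have hs : IsSymmSndFDerivAt ℝ φ p :=
    h.contDiffAt.isSymmSndFDerivAt (by simpa using WithTop.coe_le_coe.2 (le_top : (2 : ℕ∞) ≤ ⊤))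
  have hd : DifferentiableAt ℝ (fderiv ℝ φ) p :=
    ((h.fderiv_right (m := ∞) (by simp)).differentiable (by simp)) p
  have h1 : ∀ a b : ℝ × ℝ, fderiv ℝ (fun q => fderiv ℝ φ q a) p b = fderiv ℝ (fderiv ℝ φ) p b a := by
    intro a b
    rw [fderiv_clm_apply hd (differentiableAt_const a)]
    simp
  change fderiv ℝ (fun q => fderiv ℝ φ q (1, 0)) p (0, 1) =
    fderiv ℝ (fun q => fderiv ℝ φ q (0, 1)) p (1, 0)
  rw [h1, h1]
  exact hs _ _

lemma IsTest.pd {X : ℝ} {φ : ℝ × ℝ → ℝ} (h : IsTest X φ) (a : ℝ × ℝ) :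
    IsTest X (fun p => fderiv ℝ φ p a) where
  smooth := (h.smooth.fderiv_right (m := ∞) (by simp)).clm_apply contDiff_const
  compact := h.compact.fderiv_apply (𝕜 := ℝ) a
  supp := (tsupport_fderiv_apply_subset ℝ a).trans h.supp

lemma IsTest.pdx {X : ℝ} {φ : ℝ × ℝ → ℝ} (h : IsTest X φ) : IsTest X (pdx φ) := h.pd _

lemma IsTest.pdv {X : ℝ} {φ : ℝ × ℝ → ℝ} (h : IsTest X φ) : IsTest X (pdv φ) := h.pd _

lemma IsTest.iter {X : ℝ} (i j : ℕ) {φ : ℝ × ℝ → ℝ} (h : IsTest X φ) :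
    IsTest X (Kolmogorov.pdx^[i] (Kolmogorov.pdv^[j] φ)) := by
  have h2 : IsTest X (Kolmogorov.pdv^[j] φ) := by
    induction j with
    | zero => exact h
    | succ n ih => rw [Function.iterate_succ_apply']; exact ih.pdv
  induction i with
  | zero => exact h2
  | succ n ih => rw [Function.iterate_succ_apply']; exact ih.pdx

lemma IsTest.integrable_mul {X : ℝ} {φ : ℝ × ℝ → ℝ} (h : IsTest X φ) (w : L2 X) :
    Integrable (fun p => w p * φ p) (volume.restrict (Omega X)) :=
  (Lp.memLp w).integrable_mul
    (h.smooth.continuous.memLp_of_hasCompactSupport (p := 2) h.compact)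

lemma IsWeakDeriv.add {X : ℝ} {i j : ℕ} {w g w' g' : L2 X} (h : IsWeakDeriv X i j w g)
    (h' : IsWeakDeriv X i j w' g') : IsWeakDeriv X i j (w + w') (g + g') := by
  intro φ hφ
  have key : ∀ (a b : L2 X) (ψ : ℝ × ℝ → ℝ), IsTest X ψ →
      ∫ p in Omega X, (a + b) p * ψ p =
        (∫ p in Omega X, a p * ψ p) + ∫ p in Omega X, b p * ψ p := by
    intro a b ψ hψ
    rw [← integral_add (hψ.integrable_mul a) (hψ.integrable_mul b)]
    refine integral_congr_ae ?_
    filter_upwards [Lp.coeFn_add a b] with p hp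
    rw [hp, Pi.add_apply, add_mul]
  rw [key _ _ _ (hφ.iter i j), key _ _ _ hφ, h φ hφ, h' φ hφ, mul_add]

lemma IsWeakDeriv.smul {X : ℝ} {i j : ℕ} {w g : L2 X} (c : ℝ) (h : IsWeakDeriv X i j w g) :
    IsWeakDeriv X i j (c • w) (c • g) := by
  intro φ hφ
  have key : ∀ (a : L2 X) (ψ : ℝ × ℝ → ℝ),
      ∫ p in Omega X, (c • a) p * ψ p = c * ∫ p in Omega X, a p * ψ p := by
    intro a ψ
    rw [← integral_const_mul]
    refine integral_congr_ae ?_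
    filter_upwards [Lp.coeFn_smul c a] with p hp
    rw [hp, Pi.smul_apply, smul_eq_mul, mul_assoc]
  rw [key, key, h φ hφ]
  ring

lemma IsWeakDeriv.zero {X : ℝ} {i j : ℕ} : IsWeakDeriv X i j 0 0 := by
  have h := fun (φ : ℝ × ℝ → ℝ) => integral_congr_ae
    (show (fun p => (0 : L2 X) p * φ p) =ᵐ[volume.restrict (Omega X)] fun _ => 0 by
      filter_upwards [Lp.coeFn_zero ℝ 2 (volume.restrict (Omega X))] with p hp
      rw [hp]; simp)
  intro φ _
  rw [h, h]; simp

/-! ### Sobolev spaces -/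

/-- Multi-indices `(i, j)` with `i + j ≤ m`. -/
abbrev MultiIndex (m : ℕ) : Type :=
  {α : Fin (m + 1) × Fin (m + 1) // (α.1 : ℕ) + (α.2 : ℕ) ≤ m}

/-- The zero multi-index. -/
def MultiIndex.zero (m : ℕ) : MultiIndex m := ⟨(0, 0), by simp⟩

/-- The Sobolev space `H^m(Ω)`. An element is stored as the family of its weak derivatives of order
at most `m` (they are determined by the function), so that the norm inherited from the `ℓ²`-sum of
copies of `L²(Ω)` is the usual one, `‖w‖² = ∑_{|α| ≤ m} ‖D^α w‖²`. -/
def sobolev (X : ℝ) (m : ℕ) : Submodule ℝ (PiLp 2 (fun _ : MultiIndex m => L2 X)) where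
  carrier := {U | ∀ α : MultiIndex m, IsWeakDeriv X α.1.1 α.1.2 (U (MultiIndex.zero m)) (U α)}
  add_mem' := fun ha hb α => (ha α).add (hb α)
  zero_mem' := fun _ => IsWeakDeriv.zero
  smul_mem' := fun c _ ha α => (ha α).smul c

/-- `H¹(Ω)`. -/
abbrev H1 (X : ℝ) : Type := sobolev X 1

/-- `H²(Ω)`. -/
abbrev H2 (X : ℝ) : Type := sobolev X 2

/-- The underlying `L²` function of an element of `H¹(Ω)`. -/
def H1.fn {X : ℝ} (w : H1 X) : L2 X := w.1 ⟨(0, 0), by decide⟩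

/-- The weak gradient `(w_x, w_v)` of an element of `H¹(Ω)`. -/
def H1.grad {X : ℝ} (w : H1 X) : Fin 2 → L2 X :=
  ![w.1 ⟨(1, 0), by decide⟩, w.1 ⟨(0, 1), by decide⟩]

/-- The element of `H¹(Ω)` with given weak derivatives. -/
def H1.mk {X : ℝ} (w wx wv : L2 X) (hx : IsWeakDeriv X 1 0 w wx) (hv : IsWeakDeriv X 0 1 w wv) :
    H1 X :=
  ⟨WithLp.toLp 2 (fun α => if α.1 = (0, 0) then w else if α.1 = (1, 0) then wx else wv), by
    rintro ⟨⟨i, j⟩, h⟩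
    fin_cases i <;> fin_cases j
    · intro φ _; simp [MultiIndex.zero]
    · simpa [MultiIndex.zero] using hv
    · simpa [MultiIndex.zero] using hx
    · simp at h⟩

/-- The inclusion of `H²(Ω)` in `H¹(Ω)`. -/
def H2.toH1 {X : ℝ} (w : H2 X) : H1 X :=
  H1.mk (w.1 ⟨(0, 0), by decide⟩) (w.1 ⟨(1, 0), by decide⟩) (w.1 ⟨(0, 1), by decide⟩)
    (w.2 ⟨(1, 0), by decide⟩) (w.2 ⟨(0, 1), by decide⟩)

/-- The derivative `w_x`, as an element of `H¹(Ω)`, of an element of `H²(Ω)`. -/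
def H2.dx {X : ℝ} (w : H2 X) : H1 X :=
  H1.mk (w.1 ⟨(1, 0), by decide⟩) (w.1 ⟨(2, 0), by decide⟩) (w.1 ⟨(1, 1), by decide⟩)
    (by
      intro φ hφ
      have h1 := w.2 ⟨(1, 0), by decide⟩ _ hφ.pdx
      have h2 := w.2 ⟨(2, 0), by decide⟩ _ hφ
      simp at h1 h2 ⊢
      linarith)
    (by
      intro φ hφ
      have h1 := w.2 ⟨(1, 0), by decide⟩ _ hφ.pdv
      have h2 := w.2 ⟨(1, 1), by decide⟩ _ hφ
      simp at h1 h2 ⊢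
      linarith)

/-- The derivative `w_v`, as an element of `H¹(Ω)`, of an element of `H²(Ω)`. -/
def H2.dv {X : ℝ} (w : H2 X) : H1 X :=
  H1.mk (w.1 ⟨(0, 1), by decide⟩) (w.1 ⟨(1, 1), by decide⟩) (w.1 ⟨(0, 2), by decide⟩)
    (by
      intro φ hφ
      have h1 := w.2 ⟨(0, 1), by decide⟩ _ hφ.pdx
      have h2 := w.2 ⟨(1, 1), by decide⟩ _ hφ
      simp [pdx_eq_pdv_comm hφ.smooth] at h1 h2 ⊢
      linarith)
    (by
      intro φ hφ
      have h1 := w.2 ⟨(0, 1), by decide⟩ _ hφ.pdv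
      have h2 := w.2 ⟨(0, 2), by decide⟩ _ hφ
      simp at h1 h2 ⊢
      linarith)

/-- Multiplication by the bounded function `v` preserves `L²(Ω)`. -/
lemma memLp_mulV {X : ℝ} (w : L2 X) :
    MemLp (fun p : ℝ × ℝ => p.2 * w p) 2 (volume.restrict (Omega X)) := by
  refine (Lp.memLp w).of_le (measurable_snd.aestronglyMeasurable.mul
    (Lp.aestronglyMeasurable w)) ?_
  refine (ae_restrict_iff' (measurableSet_Ioo.prod measurableSet_Ioo)).2 (ae_of_all _ ?_)
  rintro p ⟨_, hp⟩
  rw [norm_mul]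
  have : ‖p.2‖ ≤ 1 := by rw [Real.norm_eq_abs, abs_le]; exact ⟨hp.1.le, hp.2.le⟩
  exact mul_le_of_le_one_left (norm_nonneg _) this

/-- Multiplication of an `L²(Ω)` function by `v`. -/
def L2.mulV {X : ℝ} (w : L2 X) : L2 X := (memLp_mulV w).toLp _

lemma L2.integral_mulV {X : ℝ} (w : L2 X) (φ : ℝ × ℝ → ℝ) :
    ∫ p in Omega X, (L2.mulV w) p * φ p = ∫ p in Omega X, w p * (p.2 * φ p) := by
  refine integral_congr_ae ?_
  filter_upwards [(memLp_mulV w).coeFn_toLp] with p hp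
  rw [L2.mulV, hp]; ring

lemma IsTest.snd_mul {X : ℝ} {φ : ℝ × ℝ → ℝ} (h : IsTest X φ) :
    IsTest X (fun p => p.2 * φ p) where
  smooth := contDiff_snd.mul h.smooth
  compact := h.compact.mul_left
  supp := (tsupport_mul_subset_right).trans h.supp

lemma IsWeakDeriv.mulV_x {X : ℝ} {w wx : L2 X} (h : IsWeakDeriv X 1 0 w wx) :
    IsWeakDeriv X 1 0 (L2.mulV w) (L2.mulV wx) := by
  intro φ hφ
  have h1 := h _ hφ.snd_mul
  have h2 : Kolmogorov.pdx (fun p => p.2 * φ p) = fun p => p.2 * Kolmogorov.pdx φ p := by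
    funext p
    simp only [Kolmogorov.pdx]
    rw [fderiv_fun_mul differentiableAt_snd (hφ.smooth.differentiable (by simp) p)]
    simp [fderiv_snd]
  simp only [Function.iterate_one, Function.iterate_zero, id, h2] at h1 ⊢
  rw [L2.integral_mulV, L2.integral_mulV, h1]

lemma IsWeakDeriv.mulV_v {X : ℝ} {w wv : L2 X} (h : IsWeakDeriv X 0 1 w wv) :
    IsWeakDeriv X 0 1 (L2.mulV w) (w + L2.mulV wv) := by
  intro φ hφ
  have h1 := h _ hφ.snd_mul
  have h2 : Kolmogorov.pdv (fun p => p.2 * φ p) = fun p => p.2 * Kolmogorov.pdv φ p + φ p := by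
    funext p
    simp only [Kolmogorov.pdv]
    rw [fderiv_fun_mul differentiableAt_snd (hφ.smooth.differentiable (by simp) p)]
    simp [fderiv_snd]
  simp only [Function.iterate_one, Function.iterate_zero, id, h2, mul_add] at h1 ⊢
  rw [integral_add (hφ.pdv.snd_mul.integrable_mul w) (hφ.integrable_mul w)] at h1
  have h3 : ∫ p in Omega X, (w + L2.mulV wv) p * φ p =
      (∫ p in Omega X, w p * φ p) + ∫ p in Omega X, L2.mulV wv p * φ p := by
    rw [← integral_add (hφ.integrable_mul w) (hφ.integrable_mul _)]
    refine integral_congr_ae ?_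
    filter_upwards [Lp.coeFn_add w (L2.mulV wv)] with p hp
    rw [hp, Pi.add_apply, add_mul]
  rw [h3, L2.integral_mulV, L2.integral_mulV]
  simp at h1 ⊢
  linarith

/-- Multiplication by `v` on `H¹(Ω)`: `(v w)_x = v w_x` and `(v w)_v = w + v w_v`. -/
def H1.mulV {X : ℝ} (w : H1 X) : H1 X :=
  H1.mk (L2.mulV w.fn) (L2.mulV (w.grad 0)) (w.fn + L2.mulV (w.grad 1))
    (IsWeakDeriv.mulV_x (w.2 ⟨(1, 0), by decide⟩))
    (IsWeakDeriv.mulV_v (w.2 ⟨(0, 1), by decide⟩))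

/-! ### Traces -/

/-- `g` is the boundary trace of `w ∈ H¹(Ω)`: the trace operator is the continuous extension to
`H¹(Ω)` of the restriction to the boundary of functions smooth up to the boundary. -/
def IsTrace {X : ℝ} (w : H1 X) (g : ℝ × ℝ → ℝ) : Prop :=
  MemLp g 2 (bdryMeasure X) ∧ ∃ φ : ℕ → ℝ × ℝ → ℝ, (∀ n, ContDiff ℝ ∞ (φ n)) ∧
    Tendsto (fun n => eLpNorm (fun p => φ n p - w.fn p) 2 (volume.restrict (Omega X))) atTop (𝓝 0) ∧
    Tendsto (fun n => eLpNorm (fun p => pdx (φ n) p - w.grad 0 p) 2 (volume.restrict (Omega X)))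
      atTop (𝓝 0) ∧
    Tendsto (fun n => eLpNorm (fun p => pdv (φ n) p - w.grad 1 p) 2 (volume.restrict (Omega X)))
      atTop (𝓝 0) ∧
    Tendsto (fun n => eLpNorm (fun p => φ n p - g p) 2 (bdryMeasure X)) atTop (𝓝 0)

/-- `w = 0` on the part `Γ` of the boundary, in the sense of traces. -/
def VanishesOn {X : ℝ} (w : H1 X) (Γ : Set (ℝ × ℝ)) : Prop :=
  ∃ g : ℝ × ℝ → ℝ, IsTrace w g ∧ g =ᵐ[(bdryMeasure X).restrict Γ] 0

/-! ### The hypocoercive structure -/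

/-- The inner product `⟨w, φ⟩_𝓗 = ⟨w, φ⟩ + ⟨∇w, M ∇φ⟩` on `H¹(Ω)`. -/
def hInner {X : ℝ} (M : Matrix (Fin 2) (Fin 2) ℝ) (w φ : H1 X) : ℝ :=
  inner ℝ w.fn φ.fn + ∑ i, inner ℝ (w.grad i) (∑ j, M i j • φ.grad j)

/-- The norm associated with `hInner`. -/
def hNorm {X : ℝ} (M : Matrix (Fin 2) (Fin 2) ℝ) (w : H1 X) : ℝ := √(hInner M w w)

/-- The bilinear form `a(w, φ) = ⟨v w_x, φ⟩_𝓗 + ε ⟨w_v, φ_v⟩_𝓗`. -/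
def aForm {X : ℝ} (ε : ℝ) (M : Matrix (Fin 2) (Fin 2) ℝ) (w φ : H2 X) : ℝ :=
  hInner M w.dx.mulV φ.toH1 + ε * hInner M w.dv φ.dv

/-- The positive semidefinite square root of a symmetric positive semidefinite matrix. -/
def matSqrt (M : Matrix (Fin 2) (Fin 2) ℝ) : Matrix (Fin 2) (Fin 2) ℝ := cfc Real.sqrt M

/-- The space of `w ∈ H²(Ω)` with `w = 0` and `√M ∇w = 0` on the Dirichlet boundary. -/
def H20 (X : ℝ) (M : Matrix (Fin 2) (Fin 2) ℝ) : Set (H2 X) :=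
  {w | VanishesOn w.toH1 (dirichletBdry X) ∧
    ∀ i, VanishesOn (matSqrt M i 0 • w.dx + matSqrt M i 1 • w.dv) (dirichletBdry X)}

/-- The smallest eigenvalue of a symmetric matrix. -/
def lamMin (A : Matrix (Fin 2) (Fin 2) ℝ) : ℝ := sInf (spectrum ℝ A)

/-- The largest eigenvalue of a symmetric matrix. -/
def lamMax (A : Matrix (Fin 2) (Fin 2) ℝ) : ℝ := sSup (spectrum ℝ A)

/-- The matrix `N = [M₁₂, M₂₂/2; M₂₂/2, ε]`. -/
def matN (ε : ℝ) (M : Matrix (Fin 2) (Fin 2) ℝ) : Matrix (Fin 2) (Fin 2) ℝ :=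
  !![M 0 1, M 1 1 / 2; M 1 1 / 2, ε]

/-- The best constant `C` in `‖w‖ ≤ C ‖∇w‖` for `w ∈ H¹(Ω)` vanishing on the Dirichlet boundary. -/
def poincareConst (X : ℝ) : ℝ :=
  sInf {C : ℝ | 0 ≤ C ∧ ∀ w : H1 X, VanishesOn w (dirichletBdry X) →
    ‖w.fn‖ ≤ C * √(‖w.grad 0‖ ^ 2 + ‖w.grad 1‖ ^ 2)}

/-- The rate `δ = max(1, λ₊(M))⁻¹ (1 + C_p²)⁻¹ λ₋(N)`. -/
def rate (Cp ε : ℝ) (M : Matrix (Fin 2) (Fin 2) ℝ) : ℝ :=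
  (max 1 (lamMax M))⁻¹ * (1 + Cp ^ 2)⁻¹ * lamMin (matN ε M)

/-- `sup_{t ∈ (0,T)} ‖f(t)‖_𝓗`; for `f` continuous on `[0,T]` this is the supremum over `[0,T]`. -/
def supNorm {X : ℝ} (T : ℝ) (M : Matrix (Fin 2) (Fin 2) ℝ) (f : ℝ → H1 X) : ℝ :=
  sSup ((fun t => hNorm M (f t)) '' Ioo 0 T)

/-- `u : [0,T] → H¹(Ω)` solves the hypocoercive weak form with source `f` and initial datum `u₀`:
on `(0,T)` it is a `C¹` function with values in `H20` whose `𝓗`-norm is `C¹`, it satisfies the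
equation for every test function and almost every time, it is `𝓗`-continuous on `[0,T]`, and
`u(0) = u₀`. -/
structure IsSolution {X : ℝ} (T ε : ℝ) (M : Matrix (Fin 2) (Fin 2) ℝ) (f : ℝ → H1 X) (u₀ : H1 X)
    (u : ℝ → H1 X) : Prop where
  weak : ∃ U : ℝ → H2 X,
    ContDiffOn ℝ 1 U (Ioo 0 T) ∧
    (∀ t ∈ Ioo 0 T, U t ∈ H20 X M ∧ (U t).toH1 = u t) ∧
    ∀ φ ∈ H20 X M, ∀ᵐ t ∂(volume.restrict (Ioo 0 T)),
      hInner M (deriv U t).toH1 φ.toH1 + aForm ε M (U t) φ = hInner M (f t) φ.toH1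
  norm_C1 : ContDiffOn ℝ 1 (fun t => hNorm M (u t)) (Ioo 0 T)
  cont : ∀ s ∈ Icc 0 T, Tendsto (fun t => hNorm M (u t - u s)) (𝓝[Icc 0 T] s) (𝓝 0)
  init : u 0 = u₀

/-- The right-hand side `e^{-δτ} ‖u₀‖²_𝓗 + (1 - e^{-δτ}) δ⁻² ‖f‖²` of the stability estimate. -/
def stabBound {X : ℝ} (δ T : ℝ) (M : Matrix (Fin 2) (Fin 2) ℝ) (f : ℝ → H1 X) (u₀ : H1 X)
    (τ : ℝ) : ℝ :=
  Real.exp (-δ * τ) * hNorm M u₀ ^ 2 +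
    (1 - Real.exp (-δ * τ)) / δ ^ 2 * supNorm T M f ^ 2

end Kolmogorov

end

open Kolmogorov

namespace Kolmogorov

/-! ### Symmetric matrices -/

/-! The form `aForm` is coercive for the `𝓗`-norm with constant `rate`, although the equation
diffuses only in `v`. In `a(w, w)`, the commutator `∂ᵥ(v w_x) = w_x + v w_xv` produces `M₁₂‖w_x‖² +
M₂₂⟨w_x, w_v⟩`. Together with `ε‖w_v‖²` this is the quadratic form of `N` at `∇w`, positive definite
because `4εM₁₂ > M₂₂²` (`lamMin_matN_pos`).

What is left is `ε⟨∇w_v, M∇w_v⟩ ≥ 0` and transport terms `⟨v z_x, z⟩`, with `z` either `w` or a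
component of `√M ∇w`. Each equals half a boundary integral of `v z²` with the sign of the outward
normal. It is nonnegative, since `z` vanishes on the inflow part (`inner_mulV_nonneg`). Hence
`le_aForm`; bounding the `𝓗`-norm by the gradient with Poincaré and `λ_max(M)` gives
`rate_mul_le_aForm`.

Testing with `φ = u(t)` and applying Young's inequality gives `(‖u‖²)' ≤ -δ‖u‖² + ‖f‖²/δ`, and
Grönwall (`le_of_deriv_le`) yields the bound `B(τ)`. Being affine in `e^{-δτ}`, `B` is monotone and
bounded by its endpoint values. -/

lemma matSqrt_mul_self {M : Matrix (Fin 2) (Fin 2) ℝ} (hM : M.PosSemidef) :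
    matSqrt M * matSqrt M = M := by
  have hsa : IsSelfAdjoint M := hM.isHermitian
  have hsp : ∀ x ∈ spectrum ℝ M, 0 ≤ x := fun x hx =>
    (Matrix.posSemidef_iff_isHermitian_and_spectrum_nonneg.1 hM).2 hx
  unfold matSqrt
  rw [← cfc_mul Real.sqrt Real.sqrt M (by fun_prop) (by fun_prop)]
  conv_rhs => rw [← cfc_id ℝ M]
  exact cfc_congr fun x hx => Real.mul_self_sqrt (hsp x hx)

lemma matSqrt_transpose (M : Matrix (Fin 2) (Fin 2) ℝ) : (matSqrt M).transpose = matSqrt M := by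
  have h : IsSelfAdjoint (matSqrt M) := cfc_predicate Real.sqrt M
  rw [← Matrix.conjTranspose_eq_transpose_of_trivial]
  exact h

lemma sum_matSqrt_mul {M : Matrix (Fin 2) (Fin 2) ℝ} (hM : M.PosSemidef) (i j : Fin 2) :
    ∑ k, matSqrt M k i * matSqrt M k j = M i j := by
  conv_rhs => rw [← matSqrt_mul_self hM, Matrix.mul_apply]
  refine Finset.sum_congr rfl fun k _ => ?_
  rw [← Matrix.transpose_apply (matSqrt M) i k, matSqrt_transpose]

lemma algebraMap_isHermitian (c : ℝ) :
    (algebraMap ℝ (Matrix (Fin 2) (Fin 2) ℝ) c).IsHermitian := by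
  ext i j
  simp [Matrix.algebraMap_matrix_apply, eq_comm]

section Hilbert

variable {E : Type*} [NormedAddCommGroup E] [InnerProductSpace ℝ E]

/-- Diagonalises the coupling by `M`. With `E = L²(Ω)`, it turns the gradient part of `⟨·,·⟩_𝓗` into
a sum of scalar products of the components of `√M ∇w`, the quantities on which the boundary
condition is imposed. -/
lemma sum_inner_eq_sum_matSqrt {M : Matrix (Fin 2) (Fin 2) ℝ} (hM : M.PosSemidef)
    (y z : Fin 2 → E) :
    ∑ i, inner ℝ (y i) (∑ j, M i j • z j) =
      ∑ k, inner ℝ (∑ i, matSqrt M k i • y i) (∑ j, matSqrt M k j • z j) := by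
  have h := sum_matSqrt_mul hM
  simp only [Fin.sum_univ_two] at h
  simp only [Fin.sum_univ_two, inner_add_left, inner_add_right, real_inner_smul_left,
    real_inner_smul_right, ← h]
  ring

lemma sum_inner_nonneg {M : Matrix (Fin 2) (Fin 2) ℝ} (hM : M.PosSemidef) (y : Fin 2 → E) :
    0 ≤ ∑ i, inner ℝ (y i) (∑ j, M i j • y j) := by
  rw [sum_inner_eq_sum_matSqrt hM]
  exact Finset.sum_nonneg fun k _ => real_inner_self_nonneg

lemma posSemidef_sub_lamMin {A : Matrix (Fin 2) (Fin 2) ℝ} (hA : A.IsHermitian) :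
    (A - algebraMap ℝ _ (lamMin A)).PosSemidef := by
  have hc : (algebraMap ℝ (Matrix (Fin 2) (Fin 2) ℝ) (lamMin A)).IsHermitian :=
    algebraMap_isHermitian _
  refine Matrix.posSemidef_iff_isHermitian_and_spectrum_nonneg.2 ⟨hA.sub hc, ?_⟩
  rw [← spectrum.sub_singleton_eq]
  rintro _ ⟨x, hx, _, rfl, rfl⟩
  exact sub_nonneg.2 (csInf_le Matrix.finite_real_spectrum.bddBelow hx)

lemma posSemidef_lamMax_sub {A : Matrix (Fin 2) (Fin 2) ℝ} (hA : A.IsHermitian) :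
    (algebraMap ℝ _ (lamMax A) - A).PosSemidef := by
  have hc : (algebraMap ℝ (Matrix (Fin 2) (Fin 2) ℝ) (lamMax A)).IsHermitian :=
    algebraMap_isHermitian _
  refine Matrix.posSemidef_iff_isHermitian_and_spectrum_nonneg.2 ⟨hc.sub hA, ?_⟩
  rw [← spectrum.singleton_sub_eq]
  rintro _ ⟨_, rfl, x, hx, rfl⟩
  exact sub_nonneg.2 (le_csSup Matrix.finite_real_spectrum.bddAbove hx)

lemma lamMin_mul_le {A : Matrix (Fin 2) (Fin 2) ℝ} (hA : A.IsHermitian) (y : Fin 2 → E) :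
    lamMin A * (‖y 0‖ ^ 2 + ‖y 1‖ ^ 2) ≤ ∑ i, inner ℝ (y i) (∑ j, A i j • y j) := by
  have h := sum_inner_nonneg (posSemidef_sub_lamMin hA) y
  simp [Fin.sum_univ_two, inner_add_right, real_inner_smul_right, sub_smul, inner_sub_right,
    Matrix.algebraMap_matrix_apply] at h ⊢
  linarith

lemma le_lamMax_mul {A : Matrix (Fin 2) (Fin 2) ℝ} (hA : A.IsHermitian) (y : Fin 2 → E) :
    ∑ i, inner ℝ (y i) (∑ j, A i j • y j) ≤ lamMax A * (‖y 0‖ ^ 2 + ‖y 1‖ ^ 2) := by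
  have h := sum_inner_nonneg (posSemidef_lamMax_sub hA) y
  simp [Fin.sum_univ_two, inner_add_right, real_inner_smul_right, sub_smul, inner_sub_right,
    Matrix.algebraMap_matrix_apply] at h ⊢
  linarith

end Hilbert

lemma matN_isHermitian (ε : ℝ) (M : Matrix (Fin 2) (Fin 2) ℝ) : (matN ε M).IsHermitian := by
  ext i j
  fin_cases i <;> fin_cases j <;> simp [matN]

lemma lamMin_matN_pos {ε : ℝ} {M : Matrix (Fin 2) (Fin 2) ℝ} (hε : 0 < ε)
    (hMN : M 1 1 ^ 2 < 4 * ε * M 0 1) : 0 < lamMin (matN ε M) := by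
  have hH := matN_isHermitian ε M
  have hne : (spectrum ℝ (matN ε M)).Nonempty := ⟨_, hH.eigenvalues_mem_spectrum_real 0⟩
  have hmem : lamMin (matN ε M) ∈ spectrum ℝ (matN ε M) :=
    hne.csInf_mem Matrix.finite_real_spectrum
  set l := lamMin (matN ε M)
  rw [spectrum.mem_iff, Matrix.isUnit_iff_isUnit_det, isUnit_iff_ne_zero, not_not,
    Matrix.det_fin_two] at hmem
  -- The smallest eigenvalue `l` is a root of `l² - (M₁₂ + ε) l + (εM₁₂ - M₂₂²/4)`, and this
  -- polynomial is positive for every `l ≤ 0`.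
  simp [matN, Matrix.algebraMap_matrix_apply] at hmem
  have h01 : 0 < M 0 1 := by
    by_contra h
    nlinarith [sq_nonneg (M 1 1)]
  by_contra h
  have := mul_nonneg (neg_nonneg.2 (not_lt.1 h)) (add_pos hε h01).le
  nlinarith [sq_nonneg l]

/-! ### Integration by parts for smooth functions -/

lemma restrict_Omega_eq (X : ℝ) : (volume.restrict (Omega X) : Measure (ℝ × ℝ)) =
    volume.restrict (Icc (-X, -1) (X, 1)) := by
  rw [← Icc_prod_Icc, Omega, Measure.volume_eq_prod, ← Measure.prod_restrict,
    ← Measure.prod_restrict, restrict_Ioo_eq_restrict_Icc, restrict_Ioo_eq_restrict_Icc]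

lemma integrable_Omega {X : ℝ} {h : ℝ × ℝ → ℝ} (hh : Continuous h) :
    Integrable h (volume.restrict (Omega X)) := by
  rw [restrict_Omega_eq]
  exact hh.continuousOn.integrableOn_compact isCompact_Icc

lemma memLp_Omega {X : ℝ} {h : ℝ × ℝ → ℝ} (hh : Continuous h) :
    MemLp h 2 (volume.restrict (Omega X)) :=
  (memLp_two_iff_integrable_sq hh.aestronglyMeasurable).2 (integrable_Omega (hh.pow 2))

lemma continuous_pdx {φ : ℝ × ℝ → ℝ} (h : ContDiff ℝ ∞ φ) : Continuous (pdx φ) :=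
  (h.continuous_fderiv (by simp)).clm_apply continuous_const

lemma continuous_pdv {φ : ℝ × ℝ → ℝ} (h : ContDiff ℝ ∞ φ) : Continuous (pdv φ) :=
  (h.continuous_fderiv (by simp)).clm_apply continuous_const

lemma integral_pdx {X : ℝ} (hX : 0 < X) {F : ℝ × ℝ → ℝ} (hF : ContDiff ℝ ∞ F) :
    ∫ p in Omega X, pdx F p = (∫ v in (-1)..1, F (X, v)) - ∫ v in (-1)..1, F (-X, v) := by
  have hd : ∀ p, HasFDerivAt F (fderiv ℝ F p) p := fun p =>
    (hF.differentiable (by simp) p).hasFDerivAt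
  have hi : IntegrableOn (fun p => fderiv ℝ F p (1, 0)) (Icc (-X, -1) (X, 1)) volume :=
    (continuous_pdx hF).continuousOn.integrableOn_compact isCompact_Icc
  have h := integral_divergence_prod_Icc_of_hasFDerivAt_of_le F 0 (fderiv ℝ F) 0 (-X, -1) (X, 1)
    ⟨by simp; linarith, by simp⟩ hF.continuous.continuousOn continuousOn_const
    (fun p _ => hd p) (fun p _ => hasFDerivAt_const (0 : ℝ) p)
    (by simpa using hi)
  rw [restrict_Omega_eq]
  simpa [pdx] using h

lemma integral_pdv {X : ℝ} (hX : 0 < X) {F : ℝ × ℝ → ℝ} (hF : ContDiff ℝ ∞ F) :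
    ∫ p in Omega X, pdv F p = (∫ x in (-X)..X, F (x, 1)) - ∫ x in (-X)..X, F (x, -1) := by
  have hd : ∀ p, HasFDerivAt F (fderiv ℝ F p) p := fun p =>
    (hF.differentiable (by simp) p).hasFDerivAt
  have hi : IntegrableOn (fun p => fderiv ℝ F p (0, 1)) (Icc (-X, -1) (X, 1)) volume :=
    (continuous_pdv hF).continuousOn.integrableOn_compact isCompact_Icc
  have h := integral_divergence_prod_Icc_of_hasFDerivAt_of_le 0 F 0 (fderiv ℝ F) (-X, -1) (X, 1)
    ⟨by simp; linarith, by simp⟩ continuousOn_const hF.continuous.continuousOn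
    (fun p _ => hasFDerivAt_const (0 : ℝ) p) (fun p _ => hd p)
    (by simpa using hi)
  rw [restrict_Omega_eq]
  simpa [pdv] using h

/-- Integrate `∂ₓ(v φ²)`. The outflow contributions have a favourable sign and are dropped; on the
inflow sides `|v| ≤ 1`. The inflow integrals are kept because smooth approximants of a function with
vanishing trace need not vanish there themselves. -/
lemma le_integral_mul_pdx {X : ℝ} (hX : 0 < X) {φ : ℝ × ℝ → ℝ} (hφ : ContDiff ℝ ∞ φ) :
    -((∫ v in Ioc (-1 : ℝ) 0, φ (X, v) ^ 2) + ∫ v in Ioo (0 : ℝ) 1, φ (-X, v) ^ 2) ≤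
      2 * ∫ p in Omega X, p.2 * pdx φ p * φ p := by
  have hF : ContDiff ℝ ∞ (fun p : ℝ × ℝ => p.2 * φ p ^ 2) := contDiff_snd.mul (hφ.pow 2)
  have hpd : pdx (fun p : ℝ × ℝ => p.2 * φ p ^ 2) = fun p => 2 * (p.2 * pdx φ p * φ p) := by
    funext p
    have hd := hφ.differentiable (by simp) p
    simp only [pdx]
    rw [fderiv_fun_mul differentiableAt_snd (hd.fun_pow 2), fderiv_fun_pow 2 hd]
    simp [fderiv_snd]
    ring
  have h := integral_pdx hX hF
  rw [hpd, integral_const_mul] at h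
  rw [h]
  have hc : ∀ y a b : ℝ, IntervalIntegrable (fun v => v * φ (y, v) ^ 2) volume a b := fun y a b =>
    (Continuous.intervalIntegrable (by have := hφ.continuous; fun_prop) a b)
  have hc' : ∀ y a b : ℝ, IntervalIntegrable (fun v => φ (y, v) ^ 2) volume a b := fun y a b =>
    (Continuous.intervalIntegrable (by have := hφ.continuous; fun_prop) a b)
  have e1 : -(∫ v in (-1)..0, φ (X, v) ^ 2) ≤ ∫ v in (-1)..0, v * φ (X, v) ^ 2 := by
    rw [← intervalIntegral.integral_neg]
    refine intervalIntegral.integral_mono_on (by norm_num) (hc' _ _ _).neg (hc _ _ _) ?_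
    intro v hv
    nlinarith [hv.1, sq_nonneg (φ (X, v))]
  have e2 : 0 ≤ ∫ v in (0)..1, v * φ (X, v) ^ 2 :=
    intervalIntegral.integral_nonneg (by norm_num) fun v hv => mul_nonneg hv.1 (sq_nonneg _)
  have e3 : ∫ v in (0)..1, v * φ (-X, v) ^ 2 ≤ ∫ v in (0)..1, φ (-X, v) ^ 2 := by
    refine intervalIntegral.integral_mono_on (by norm_num) (hc _ _ _) (hc' _ _ _) ?_
    intro v hv
    nlinarith [hv.2, sq_nonneg (φ (-X, v))]
  have e4 : 0 ≤ -∫ v in (-1)..0, v * φ (-X, v) ^ 2 := by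
    rw [← intervalIntegral.integral_neg]
    refine intervalIntegral.integral_nonneg (by norm_num) fun v hv => ?_
    nlinarith [hv.2, sq_nonneg (φ (-X, v))]
  rw [← integral_Ioc_eq_integral_Ioo,
    ← intervalIntegral.integral_add_adjacent_intervals (hc X (-1) 0) (hc X 0 1),
    ← intervalIntegral.integral_add_adjacent_intervals (hc (-X) (-1) 0) (hc (-X) 0 1),
    ← intervalIntegral.integral_of_le (by norm_num), ← intervalIntegral.integral_of_le (by norm_num)]
  linarith

/-- Integrate `∂ᵥ((1 - v) φ²)`: the weight removes the side `v = 1`, so only the values on `v = -1`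
enter. -/
lemma integral_sq_le {X : ℝ} (hX : 0 < X) {φ : ℝ × ℝ → ℝ} (hφ : ContDiff ℝ ∞ φ) :
    ∫ p in Omega X, φ p ^ 2 ≤
      4 * (∫ x in Ioo (-X) X, φ (x, -1) ^ 2) + 16 * ∫ p in Omega X, pdv φ p ^ 2 := by
  have hF : ContDiff ℝ ∞ (fun p : ℝ × ℝ => (1 - p.2) * φ p ^ 2) :=
    (contDiff_const.sub contDiff_snd).mul (hφ.pow 2)
  have hpd : pdv (fun p : ℝ × ℝ => (1 - p.2) * φ p ^ 2) =
      fun p => 2 * (1 - p.2) * φ p * pdv φ p - φ p ^ 2 := by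
    funext p
    have hd := hφ.differentiable (by simp) p
    simp only [pdv]
    rw [fderiv_fun_mul (differentiableAt_snd.const_sub 1) (hd.fun_pow 2), fderiv_fun_pow 2 hd,
      fderiv_const_sub]
    simp [fderiv_snd]
    ring
  have h := integral_pdv hX hF
  have hc := hφ.continuous
  have hc' := continuous_pdv hφ
  have i1 : Integrable (fun p => 8 * pdv φ p ^ 2) (volume.restrict (Omega X)) :=
    integrable_Omega (by fun_prop)
  have i2 : Integrable (fun p => φ p ^ 2 / 2) (volume.restrict (Omega X)) :=
    integrable_Omega (by fun_prop)
  have hle : ∫ p in Omega X, (2 * (1 - p.2) * φ p * pdv φ p - φ p ^ 2) ≤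
      ∫ p in Omega X, (8 * pdv φ p ^ 2 - φ p ^ 2 / 2) := by
    refine setIntegral_mono_on (integrable_Omega (by fun_prop)) (i1.sub i2)
      (measurableSet_Ioo.prod measurableSet_Ioo) ?_
    rintro p ⟨_, hp⟩
    have h1 : (1 - p.2) ^ 2 ≤ 4 := by nlinarith [hp.1, hp.2]
    -- Young: `2(1 - v)φφ_v ≤ φ²/2 + 2(1 - v)²φ_v²`, and `(1 - v)² ≤ 4` gives the factor 8.
    nlinarith [sq_nonneg (φ p - 2 * ((1 - p.2) * pdv φ p)),
      mul_le_mul_of_nonneg_right h1 (sq_nonneg (pdv φ p))]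
  rw [← hpd, h, integral_sub i1 i2, integral_const_mul, integral_div] at hle
  have e : ∫ x in (-X)..X, (1 - (-1 : ℝ)) * φ (x, -1) ^ 2 = 2 * ∫ x in Ioo (-X) X, φ (x, -1) ^ 2 := by
    rw [intervalIntegral.integral_const_mul, intervalIntegral.integral_of_le (by linarith),
      integral_Ioc_eq_integral_Ioo]
    norm_num
  simp only [e, sub_self, zero_mul, intervalIntegral.integral_zero] at hle
  linarith

/-! ### Consequences of vanishing traces -/

lemma norm_toLp_sq {α : Type*} [MeasurableSpace α] {μ : Measure α} {f : α → ℝ}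
    (hf : MemLp f 2 μ) : ‖hf.toLp f‖ ^ 2 = ∫ a, f a ^ 2 ∂μ := by
  rw [← real_inner_self_eq_norm_sq, L2.inner_def]
  refine integral_congr_ae ?_
  filter_upwards [hf.coeFn_toLp] with a ha
  rw [ha]
  simp [sq]

lemma tendsto_integral_sq_of_eLpNorm {α : Type*} [MeasurableSpace α] {μ : Measure α}
    {f : ℕ → α → ℝ} (hf : ∀ n, MemLp (f n) 2 μ)
    (h : Tendsto (fun n => eLpNorm (f n) 2 μ) atTop (𝓝 0)) :
    Tendsto (fun n => ∫ a, f n a ^ 2 ∂μ) atTop (𝓝 0) := by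
  have h1 : Tendsto (fun n => ‖(hf n).toLp (f n)‖ ^ 2) atTop (𝓝 0) := by
    simp_rw [Lp.norm_toLp]
    simpa using ((ENNReal.tendsto_toReal ENNReal.zero_ne_top).comp h).pow 2
  simpa only [norm_toLp_sq] using h1

lemma map_restrict_le_restrict {μ : Measure (ℝ × ℝ)} {s t : Set ℝ} {Γ : Set (ℝ × ℝ)}
    {h : ℝ → ℝ × ℝ} (hh : Measurable h) (hst : s ⊆ t) (hμ : (volume.restrict t).map h ≤ μ)
    (hs : ∀ x ∈ s, h x ∈ Γ) (hΓ : MeasurableSet Γ) :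
    (volume.restrict s).map h ≤ μ.restrict Γ := by
  refine le_trans ?_ (Measure.restrict_mono subset_rfl hμ)
  rw [Measure.restrict_map hh hΓ, Measure.restrict_restrict (hh hΓ)]
  exact Measure.map_mono (Measure.restrict_mono (subset_inter hs hst) le_rfl) hh

lemma measurableSet_dirichletBdry (X : ℝ) : MeasurableSet (dirichletBdry X) := by
  unfold dirichletBdry inflow parabolicBdry
  measurability

/-- On a piece of a side where the trace `g` vanishes, `φ n` agrees almost everywhere with `φ n -
g`, so the boundary convergence forces its square integral to zero. -/
lemma tendsto_integral_sq_side {X : ℝ} {g : ℝ × ℝ → ℝ} {φ : ℕ → ℝ × ℝ → ℝ}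
    (hφ : ∀ n, Continuous (φ n))
    (hg0 : g =ᵐ[(bdryMeasure X).restrict (dirichletBdry X)] 0)
    (hlim : Tendsto (fun n => eLpNorm (fun p => φ n p - g p) 2 (bdryMeasure X)) atTop (𝓝 0))
    {s : Set ℝ} {a b : ℝ} {h : ℝ → ℝ × ℝ} (hh : Continuous h) (hst : s ⊆ Icc a b)
    (hμ : (volume.restrict (Icc a b)).map h ≤ bdryMeasure X)
    (hs : ∀ x ∈ s, h x ∈ dirichletBdry X) :
    Tendsto (fun n => ∫ x in s, φ n (h x) ^ 2) atTop (𝓝 0) := by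
  have hle := map_restrict_le_restrict hh.measurable hst hμ hs (measurableSet_dirichletBdry X)
  have hm : ∀ n, MemLp (φ n) 2 ((volume.restrict s).map h) := by
    intro n
    refine (memLp_two_iff_integrable_sq (hφ n).aestronglyMeasurable).2 ?_
    refine (integrable_map_measure ((hφ n).pow 2).aestronglyMeasurable hh.aemeasurable).2 ?_
    exact ((((hφ n).pow 2).comp hh).continuousOn.integrableOn_compact isCompact_Icc).mono_set hst
  have hlim' : Tendsto (fun n => eLpNorm (φ n) 2 ((volume.restrict s).map h)) atTop (𝓝 0) := by
    refine tendsto_of_tendsto_of_tendsto_of_le_of_le tendsto_const_nhds hlim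
      (fun _ => zero_le) fun n => ?_
    have h1 : φ n =ᵐ[(volume.restrict s).map h] fun p => φ n p - g p := by
      filter_upwards [ae_mono hle hg0] with p hp
      rw [hp]
      simp
    dsimp only
    rw [eLpNorm_congr_ae h1]
    exact eLpNorm_mono_measure _ (hle.trans Measure.restrict_le_self)
  have := tendsto_integral_sq_of_eLpNorm hm hlim'
  refine this.congr fun n => ?_
  exact integral_map hh.aemeasurable ((hφ n).pow 2).aestronglyMeasurable

lemma tendsto_toLp_of_eLpNorm_sub {X : ℝ} {φ : ℕ → ℝ × ℝ → ℝ}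
    (hφ : ∀ n, Continuous (φ n)) {w : L2 X}
    (h : Tendsto (fun n => eLpNorm (fun p => φ n p - w p) 2 (volume.restrict (Omega X)))
      atTop (𝓝 0)) :
    Tendsto (fun n => (memLp_Omega (X := X) (hφ n)).toLp (φ n)) atTop (𝓝 w) := by
  rw [Lp.tendsto_Lp_iff_tendsto_eLpNorm']
  refine h.congr fun n => eLpNorm_congr_ae ?_
  filter_upwards [(memLp_Omega (X := X) (hφ n)).coeFn_toLp] with p hp
  simp [hp]

/-- Multiplication by `v` as a bounded operator on `L²(Ω)`. -/
noncomputable def mulVL (X : ℝ) : L2 X →L[ℝ] L2 X :=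
  LinearMap.mkContinuous
    { toFun := L2.mulV
      map_add' := fun a b => by
        refine Lp.ext ?_
        filter_upwards [(memLp_mulV (a + b)).coeFn_toLp, (memLp_mulV a).coeFn_toLp,
          (memLp_mulV b).coeFn_toLp, Lp.coeFn_add a b, Lp.coeFn_add (L2.mulV a) (L2.mulV b)]
          with p h1 h2 h3 h4 h5
        rw [h5, Pi.add_apply, L2.mulV, L2.mulV, L2.mulV, h1, h2, h3, h4, Pi.add_apply, mul_add]
      map_smul' := fun c a => by
        refine Lp.ext ?_
        filter_upwards [(memLp_mulV (c • a)).coeFn_toLp, (memLp_mulV a).coeFn_toLp,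
          Lp.coeFn_smul c a, Lp.coeFn_smul c (L2.mulV a)] with p h1 h2 h3 h4
        rw [RingHom.id_apply, h4, Pi.smul_apply, L2.mulV, L2.mulV, h1, h2, h3, Pi.smul_apply,
          smul_eq_mul, smul_eq_mul, mul_left_comm] }
    1 fun w => by
      rw [one_mul]
      refine Lp.norm_le_norm_of_ae_le ?_
      filter_upwards [(memLp_mulV w).coeFn_toLp,
        ae_restrict_mem (measurableSet_Ioo.prod measurableSet_Ioo)] with p h1 h2
      rw [LinearMap.coe_mk, AddHom.coe_mk, L2.mulV, h1, norm_mul]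
      refine mul_le_of_le_one_left (norm_nonneg _) ?_
      rw [Real.norm_eq_abs, abs_le]
      exact ⟨h2.2.1.le, h2.2.2.le⟩

@[simp] lemma mulVL_apply {X : ℝ} (w : L2 X) : mulVL X w = L2.mulV w := rfl

lemma continuous_mulV (X : ℝ) : Continuous (L2.mulV : L2 X → L2 X) := (mulVL X).continuous

/-- Limit of `le_integral_mul_pdx` along the smooth functions defining the trace: the inflow
integrals tend to zero and the bulk term is continuous in `L²`. -/
lemma inner_mulV_nonneg {X : ℝ} (hX : 0 < X) {w : H1 X} (hw : VanishesOn w (dirichletBdry X)) :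
    0 ≤ inner ℝ (L2.mulV (w.grad 0)) w.fn := by
  obtain ⟨g, ⟨-, φ, hφ, h0, hx, -, hb⟩, hg⟩ := hw
  have hc := fun n => (hφ n).continuous
  have hcx := fun n => continuous_pdx (hφ n)
  have l0 := tendsto_toLp_of_eLpNorm_sub hc h0
  have lx := tendsto_toLp_of_eLpNorm_sub hcx hx
  have l1 := (((continuous_mulV X).tendsto _).comp lx).inner (𝕜 := ℝ) l0
  have t1 := tendsto_integral_sq_side hc hg hb (s := Ioc (-1) 0) (a := -1) (b := 1)
    (h := fun v => (X, v)) (by fun_prop) (fun v hv => ⟨hv.1.le, by linarith [hv.2]⟩)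
    (by
      unfold bdryMeasure
      exact (Measure.le_add_left le_rfl).trans (Measure.le_add_right (Measure.le_add_right le_rfl)))
    (fun v hv => Or.inl (Or.inr ⟨rfl, hv⟩))
  have t2 := tendsto_integral_sq_side hc hg hb (s := Ioo 0 1) (a := -1) (b := 1)
    (h := fun v => (-X, v)) (by fun_prop) (fun v hv => ⟨by linarith [hv.1], hv.2.le⟩)
    (by
      unfold bdryMeasure
      exact Measure.le_add_right (Measure.le_add_right (Measure.le_add_right le_rfl)))
    (fun v hv => Or.inl (Or.inl ⟨rfl, hv.1.le, hv.2⟩))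
  have key := le_of_tendsto_of_tendsto' (t1.add t2).neg (l1.const_mul 2) fun n => by
    refine (le_integral_mul_pdx hX (hφ n)).trans (le_of_eq ?_)
    rw [Function.comp_apply, L2.inner_def]
    congr 1
    refine integral_congr_ae ?_
    filter_upwards [(memLp_Omega (X := X) (hc n)).coeFn_toLp,
      (memLp_mulV ((memLp_Omega (X := X) (hcx n)).toLp _)).coeFn_toLp,
      (memLp_Omega (X := X) (hcx n)).coeFn_toLp] with p h1 h2 h3
    rw [L2.mulV, h1, h2, h3]
    simp [mul_comm]
  simpa using key

lemma norm_sq_le_grad {X : ℝ} (hX : 0 < X) {w : H1 X} (hw : VanishesOn w (dirichletBdry X)) :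
    ‖w.fn‖ ^ 2 ≤ 16 * ‖w.grad 1‖ ^ 2 := by
  obtain ⟨g, ⟨-, φ, hφ, h0, -, hv, hb⟩, hg⟩ := hw
  have hc := fun n => (hφ n).continuous
  have hcv := fun n => continuous_pdv (hφ n)
  have l0 := tendsto_toLp_of_eLpNorm_sub hc h0
  have lv := tendsto_toLp_of_eLpNorm_sub hcv hv
  have t1 := tendsto_integral_sq_side hc hg hb (s := Ioo (-X) X) (a := -X) (b := X)
    (h := fun x => (x, -1)) (by fun_prop) Ioo_subset_Icc_self
    (by
      unfold bdryMeasure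
      exact Measure.le_add_right (Measure.le_add_left le_rfl))
    (fun x hx => Or.inr ⟨hx, Or.inl rfl⟩)
  have key := le_of_tendsto_of_tendsto' (l0.norm.pow 2)
    ((t1.const_mul 4).add ((lv.norm.pow 2).const_mul 16)) fun n => by
      rw [norm_toLp_sq, norm_toLp_sq]
      exact integral_sq_le hX (hφ n)
  simpa using key

lemma norm_le_poincareConst {X Cp : ℝ} (hX : 0 < X) (hCp : poincareConst X ≤ Cp) {w : H1 X}
    (hw : VanishesOn w (dirichletBdry X)) :
    ‖w.fn‖ ^ 2 ≤ Cp ^ 2 * (‖w.grad 0‖ ^ 2 + ‖w.grad 1‖ ^ 2) := by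
  set S := {C : ℝ | 0 ≤ C ∧ ∀ w : H1 X, VanishesOn w (dirichletBdry X) →
    ‖w.fn‖ ≤ C * √(‖w.grad 0‖ ^ 2 + ‖w.grad 1‖ ^ 2)} with hS
  have hne : S.Nonempty := by
    -- The constant 4 is the square root of the 16 in `norm_sq_le_grad`.
    refine ⟨4, by norm_num, fun w hw => ?_⟩
    refine le_of_sq_le_sq ?_ (by positivity)
    rw [mul_pow, Real.sq_sqrt (by positivity)]
    nlinarith [norm_sq_le_grad hX hw, sq_nonneg ‖w.grad 0‖]
  have hcl : IsClosed S := by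
    simp only [hS, ofPred_and, ofPred_forall]
    refine isClosed_Ici.inter (isClosed_iInter fun w => isClosed_iInter fun _ => ?_)
    exact isClosed_le continuous_const (by fun_prop)
  -- The infimum of a nonempty closed set bounded below is attained, so it is itself an admissible
  -- constant, and so is every larger `Cp`.
  have hmem : poincareConst X ∈ S := hcl.csInf_mem hne ⟨0, fun C hC => hC.1⟩
  have h := hmem.2 w hw
  have h' := h.trans (mul_le_mul_of_nonneg_right hCp (Real.sqrt_nonneg _))
  have := pow_le_pow_left₀ (norm_nonneg _) h' 2
  rwa [mul_pow, Real.sq_sqrt (by positivity)] at this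

/-! ### The hypocoercive inner product -/

section Components

variable {X : ℝ}

@[simp] lemma H1.fn_mk (w wx wv : L2 X) (hx hv) : (H1.mk w wx wv hx hv).fn = w := rfl

@[simp] lemma H1.grad_zero_mk (w wx wv : L2 X) (hx hv) : (H1.mk w wx wv hx hv).grad 0 = wx := rfl

@[simp] lemma H1.grad_one_mk (w wx wv : L2 X) (hx hv) : (H1.mk w wx wv hx hv).grad 1 = wv := rfl

@[simp] lemma H1.fn_add (w z : H1 X) : (w + z).fn = w.fn + z.fn := rfl

@[simp] lemma H1.fn_smul (c : ℝ) (w : H1 X) : (c • w).fn = c • w.fn := rfl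

@[simp] lemma H1.grad_add (w z : H1 X) (i : Fin 2) : (w + z).grad i = w.grad i + z.grad i := by
  fin_cases i <;> rfl

@[simp] lemma H1.grad_smul (c : ℝ) (w : H1 X) (i : Fin 2) : (c • w).grad i = c • w.grad i := by
  fin_cases i <;> rfl

lemma continuous_sobolev_apply {m : ℕ} (α : MultiIndex m) :
    Continuous fun w : sobolev X m => w.1 α :=
  (PiLp.continuous_apply 2 _ α).comp continuous_subtype_val

@[fun_prop] lemma H1.continuous_fn : Continuous (H1.fn : H1 X → L2 X) :=
  continuous_sobolev_apply _

@[fun_prop] lemma H1.continuous_grad (i : Fin 2) : Continuous fun w : H1 X => w.grad i := by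
  fin_cases i <;> exact continuous_sobolev_apply _

end Components

variable {X : ℝ}

lemma H2.toH1_apply (w : H2 X) (α : MultiIndex 1) : w.toH1.1 α =
    if α.1 = (0, 0) then w.1 ⟨(0, 0), by decide⟩ else
      if α.1 = (1, 0) then w.1 ⟨(1, 0), by decide⟩ else w.1 ⟨(0, 1), by decide⟩ := rfl

/-- The inclusion of `H²(Ω)` in `H¹(Ω)` as a bounded operator. -/
noncomputable def toH1L (X : ℝ) : H2 X →L[ℝ] H1 X where
  toFun := H2.toH1
  map_add' a b := by
    refine Subtype.ext (PiLp.ext fun α => ?_)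
    change (a + b).toH1.1 α = a.toH1.1 α + b.toH1.1 α
    simp only [H2.toH1_apply]
    split_ifs <;> rfl
  map_smul' c a := by
    refine Subtype.ext (PiLp.ext fun α => ?_)
    change (c • a).toH1.1 α = c • a.toH1.1 α
    simp only [H2.toH1_apply]
    split_ifs <;> rfl
  cont := by
    refine Continuous.subtype_mk ((PiLp.continuous_toLp 2 _).comp (continuous_pi fun α => ?_)) _
    split_ifs <;> exact continuous_sobolev_apply _

@[simp] lemma toH1L_apply (w : H2 X) : toH1L X w = w.toH1 := rfl

/-- The vector `(w, √M ∇w)`, whose norm is the norm `‖w‖_𝓗`. -/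
noncomputable def hVec (M : Matrix (Fin 2) (Fin 2) ℝ) :
    H1 X →L[ℝ] WithLp 2 (L2 X × PiLp 2 fun _ : Fin 2 => L2 X) where
  toFun w := WithLp.toLp 2 (w.fn, WithLp.toLp 2 fun k => ∑ i, matSqrt M k i • w.grad i)
  map_add' a b := by
    refine WithLp.ofLp_injective 2 (Prod.ext rfl (PiLp.ext fun k => ?_))
    simp [smul_add, Finset.sum_add_distrib]
  map_smul' c a := by
    refine WithLp.ofLp_injective 2 (Prod.ext rfl (PiLp.ext fun k => ?_))
    simp [smul_comm c]
  cont := by fun_prop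

lemma hInner_eq_inner {M : Matrix (Fin 2) (Fin 2) ℝ} (hM : M.PosSemidef) (w φ : H1 X) :
    hInner M w φ = inner ℝ (hVec M w) (hVec M φ) := by
  rw [hInner, sum_inner_eq_sum_matSqrt hM, WithLp.prod_inner_apply, PiLp.inner_apply]
  rfl

lemma hNorm_eq_norm {M : Matrix (Fin 2) (Fin 2) ℝ} (hM : M.PosSemidef) (w : H1 X) :
    hNorm M w = ‖hVec M w‖ := by
  rw [hNorm, hInner_eq_inner hM, real_inner_self_eq_norm_sq, Real.sqrt_sq (norm_nonneg _)]

/-- All derivatives in the form are coordinates of `w` in `H²(Ω)`, and multiplication by `v` is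
bounded. -/
lemma continuous_aForm {M : Matrix (Fin 2) (Fin 2) ℝ} (ε : ℝ) (φ : H2 X) :
    Continuous fun w : H2 X => aForm ε M w φ := by
  have h : ∀ α, Continuous fun w : H2 X => w.1 α := continuous_sobolev_apply
  have h1 : Continuous fun w : H2 X => w.dx.fn := h _
  have h2 : Continuous fun w : H2 X => w.dx.grad 0 := h _
  have h3 : Continuous fun w : H2 X => w.dx.grad 1 := h _
  have h4 : Continuous fun w : H2 X => w.dv.fn := h _
  have h5 : Continuous fun w : H2 X => w.dv.grad 0 := h _
  have h6 : Continuous fun w : H2 X => w.dv.grad 1 := h _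
  have hm := continuous_mulV X
  simp only [aForm, hInner, Fin.sum_univ_two, H1.mulV, H1.fn_mk, H1.grad_zero_mk,
    H1.grad_one_mk]
  fun_prop

lemma le_aForm {ε : ℝ} (hX : 0 < X) (hε : 0 < ε) {M : Matrix (Fin 2) (Fin 2) ℝ}
    (hM : M.PosSemidef) {w : H2 X} (hw : w ∈ H20 X M) :
    lamMin (matN ε M) * (‖w.toH1.grad 0‖ ^ 2 + ‖w.toH1.grad 1‖ ^ 2) ≤ aForm ε M w w := by
  have h10 : M 1 0 = M 0 1 := by simpa using hM.isHermitian.apply 0 1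
  have e1 : w.toH1.grad 0 = w.dx.fn := rfl
  have e2 : w.toH1.grad 1 = w.dv.fn := rfl
  have hN := lamMin_mul_le (matN_isHermitian ε M) w.toH1.grad
  have h0 := inner_mulV_nonneg hX hw.1
  -- Transport inequality for each component of `√M ∇w`, summed; it is rewritten below through `M`
  -- to match the terms of `aForm`.
  have h1 : 0 ≤ ∑ k : Fin 2, inner ℝ (∑ i, matSqrt M k i • ![L2.mulV (w.dx.grad 0),
      L2.mulV (w.dv.grad 0)] i) (∑ j, matSqrt M k j • w.toH1.grad j) := by
    refine Finset.sum_nonneg fun k _ => ?_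
    have h := inner_mulV_nonneg hX (hw.2 k)
    simp only [← mulVL_apply, H1.grad_add, H1.grad_smul, map_add, map_smul] at h
    simpa [Fin.sum_univ_two, e1, e2] using h
  rw [← sum_inner_eq_sum_matSqrt hM] at h1
  have h2 := sum_inner_nonneg hM w.dv.grad
  have h3 : 0 ≤ inner ℝ w.dv.fn w.dv.fn := real_inner_self_nonneg
  have h4 := mul_nonneg hε.le h2
  have e3 : w.dx.grad 1 = w.dv.grad 0 := rfl
  have e4 : w.dx.mulV.grad 0 = L2.mulV (w.dx.grad 0) := rfl
  -- The extra `w.dx.fn` is the commutator term, the only source of control on `w_x`.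
  have e5 : w.dx.mulV.grad 1 = w.dx.fn + L2.mulV (w.dx.grad 1) := rfl
  have e6 : w.dx.mulV.fn = L2.mulV w.dx.fn := rfl
  have e7 := real_inner_self_eq_norm_sq w.dv.fn
  rw [e1] at h0
  rw [aForm, hInner, hInner, mul_add]
  simp only [Fin.sum_univ_two, e1, e2, e3, e4, e5, e6, h10, matN, inner_add_left,
    inner_add_right, real_inner_smul_right, Matrix.cons_val_zero,
    Matrix.cons_val_one, Matrix.of_apply, Matrix.cons_val'] at hN h0 h1 h2 h4 ⊢
  have e8 := real_inner_comm w.dv.fn w.dx.fn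
  simp only [e8] at hN ⊢
  linarith

lemma hNorm_sq_le {Cp : ℝ} (hX : 0 < X) (hCp : poincareConst X ≤ Cp)
    {M : Matrix (Fin 2) (Fin 2) ℝ} (hM : M.PosSemidef) {w : H1 X}
    (hw : VanishesOn w (dirichletBdry X)) :
    hNorm M w ^ 2 ≤ max 1 (lamMax M) * (1 + Cp ^ 2) * (‖w.grad 0‖ ^ 2 + ‖w.grad 1‖ ^ 2) := by
  have h1 := norm_le_poincareConst hX hCp hw
  have h2 := le_lamMax_mul hM.isHermitian w.grad
  rw [hNorm_eq_norm hM, ← real_inner_self_eq_norm_sq, ← hInner_eq_inner hM, hInner,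
    real_inner_self_eq_norm_sq]
  set G := ‖w.grad 0‖ ^ 2 + ‖w.grad 1‖ ^ 2
  have hG : 0 ≤ G := by positivity
  have h3 : lamMax M * G ≤ max 1 (lamMax M) * G :=
    mul_le_mul_of_nonneg_right (le_max_right _ _) hG
  have h4 : 1 * (Cp ^ 2 * G) ≤ max 1 (lamMax M) * (Cp ^ 2 * G) :=
    mul_le_mul_of_nonneg_right (le_max_left _ _) (by positivity)
  linarith

lemma rate_pos {Cp ε : ℝ} {M : Matrix (Fin 2) (Fin 2) ℝ} (hε : 0 < ε)
    (hMN : M 1 1 ^ 2 < 4 * ε * M 0 1) : 0 < rate Cp ε M := by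
  have := lamMin_matN_pos hε hMN
  have : 0 < max 1 (lamMax M) := lt_max_of_lt_left one_pos
  unfold rate
  positivity

lemma rate_mul_le_aForm {Cp ε : ℝ} (hX : 0 < X) (hε : 0 < ε) (hCp : poincareConst X ≤ Cp)
    {M : Matrix (Fin 2) (Fin 2) ℝ} (hM : M.PosSemidef) (hMN : M 1 1 ^ 2 < 4 * ε * M 0 1)
    {w : H2 X} (hw : w ∈ H20 X M) : rate Cp ε M * hNorm M w.toH1 ^ 2 ≤ aForm ε M w w := by
  refine le_trans ?_ (le_aForm hX hε hM hw)
  have hm : 0 < max 1 (lamMax M) := lt_max_of_lt_left one_pos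
  have hc : 0 < 1 + Cp ^ 2 := by positivity
  refine (mul_le_mul_of_nonneg_left (hNorm_sq_le hX hCp hM hw.1) (rate_pos hε hMN).le).trans
    (le_of_eq ?_)
  unfold rate
  field_simp

/-! ### The energy estimate -/

/-- Grönwall by the integrating factor: `e^{δt}(y - K/δ²)` is nonincreasing, and continuity on the
closed interval carries this to the endpoints. -/
lemma le_of_deriv_le {y y' : ℝ → ℝ} {δ K T : ℝ} (hδ : 0 < δ)
    (hc : ContinuousOn y (Icc 0 T)) (hd : ∀ t ∈ Ioo 0 T, HasDerivAt y (y' t) t)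
    (hle : ∀ t ∈ Ioo 0 T, y' t ≤ -δ * y t + K / δ) {τ : ℝ} (hτ : τ ∈ Icc 0 T) :
    y τ ≤ Real.exp (-δ * τ) * y 0 + (1 - Real.exp (-δ * τ)) / δ ^ 2 * K := by
  have hexp : ∀ t, HasDerivAt (fun t => Real.exp (δ * t)) (Real.exp (δ * t) * δ) t := fun t => by
    simpa using ((hasDerivAt_id t).const_mul δ).exp
  have hanti : AntitoneOn (fun t => Real.exp (δ * t) * (y t - K / δ ^ 2)) (Icc 0 T) := by
    have hder : ∀ t ∈ Ioo 0 T, HasDerivAt (fun t => Real.exp (δ * t) * (y t - K / δ ^ 2))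
        (Real.exp (δ * t) * δ * (y t - K / δ ^ 2) + Real.exp (δ * t) * y' t) t := fun t ht =>
      (hexp t).mul ((hd t ht).sub_const _)
    refine antitoneOn_of_deriv_nonpos (convex_Icc 0 T) ?_ ?_ ?_
    · exact ContinuousOn.mul (by fun_prop) (hc.sub continuousOn_const)
    · rw [interior_Icc]
      exact fun t ht => (hder t ht).differentiableAt.differentiableWithinAt
    · rw [interior_Icc]
      intro t ht
      rw [(hder t ht).deriv]
      have h1 : δ * (y t - K / δ ^ 2) + y' t ≤ 0 := by
        have h2 : δ * (K / δ ^ 2) = K / δ := by field_simp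
        have := hle t ht
        rw [mul_sub, h2]
        linarith
      have := mul_nonpos_of_nonneg_of_nonpos (Real.exp_pos (δ * t)).le h1
      linarith
  have h := hanti ⟨le_rfl, hτ.1.trans hτ.2⟩ hτ hτ.1
  simp only [mul_zero, Real.exp_zero, one_mul] at h
  have h2 := mul_le_mul_of_nonneg_left h (Real.exp_pos (-δ * τ)).le
  rw [← mul_assoc, ← Real.exp_add, neg_mul, neg_add_cancel, Real.exp_zero, one_mul] at h2
  rw [neg_mul]
  have h3 : (1 - Real.exp (-(δ * τ))) / δ ^ 2 * K =
      K / δ ^ 2 - Real.exp (-(δ * τ)) * (K / δ ^ 2) := by ring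
  rw [h3]
  linarith

/-- The exceptional null set may depend on `φ`, whereas the energy argument uses the time-dependent
`φ = U t`. Both sides are continuous in time, so for each fixed `φ` the identity holds everywhere.
-/
lemma IsSolution.weak_forall {T ε : ℝ} {M : Matrix (Fin 2) (Fin 2) ℝ} (hM : M.PosSemidef)
    {f : ℝ → H1 X} (hf : ContinuousOn f (Ioo 0 T)) {U : ℝ → H2 X}
    (hU : ContDiffOn ℝ 1 U (Ioo 0 T)) {φ : H2 X}
    (h : ∀ᵐ t ∂(volume.restrict (Ioo 0 T)),
      hInner M (deriv U t).toH1 φ.toH1 + aForm ε M (U t) φ = hInner M (f t) φ.toH1) :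
    ∀ t ∈ Ioo 0 T,
      hInner M (deriv U t).toH1 φ.toH1 + aForm ε M (U t) φ = hInner M (f t) φ.toH1 := by
  refine Measure.eqOn_open_of_ae_eq h isOpen_Ioo ?_ ?_
  · refine ContinuousOn.add ?_ ((continuous_aForm ε φ).comp_continuousOn hU.continuousOn)
    simp only [hInner_eq_inner hM, ← toH1L_apply]
    have hd := hU.continuousOn_deriv_of_isOpen isOpen_Ioo le_rfl
    exact ((((hVec M).comp (toH1L X)).continuous.comp_continuousOn hd).inner continuousOn_const)
  · simp only [hInner_eq_inner hM]
    exact ((hVec M).continuous.comp_continuousOn hf).inner continuousOn_const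

/-- For singular `M` the `𝓗`-norm does not control the full gradient, so continuity up to the
endpoints is stated for `(u, √M ∇u)`. -/
lemma IsSolution.continuousOn_hVec {T ε : ℝ} {M : Matrix (Fin 2) (Fin 2) ℝ} (hM : M.PosSemidef)
    {f : ℝ → H1 X} {u₀ : H1 X} {u : ℝ → H1 X} (hu : IsSolution T ε M f u₀ u) :
    ContinuousOn (fun t => hVec M (u t)) (Icc 0 T) := by
  intro s hs
  have h := hu.cont s hs
  simp only [hNorm_eq_norm hM, map_sub] at h
  exact tendsto_iff_norm_sub_tendsto_zero.2 h

lemma IsSolution.hNorm_sq_le {T ε Cp : ℝ} (hX : 0 < X) (hε : 0 < ε)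
    (hCp : poincareConst X ≤ Cp) {M : Matrix (Fin 2) (Fin 2) ℝ} (hM : M.PosSemidef)
    (hMN : M 1 1 ^ 2 < 4 * ε * M 0 1) {f : ℝ → H1 X} (hf : ContinuousOn f (Ioo 0 T))
    (hf_bdd : BddAbove ((fun t => hNorm M (f t)) '' Ioo 0 T)) {u₀ : H1 X} {u : ℝ → H1 X}
    (hu : IsSolution T ε M f u₀ u) {τ : ℝ} (hτ : τ ∈ Icc 0 T) :
    hNorm M (u τ) ^ 2 ≤ stabBound (rate Cp ε M) T M f u₀ τ := by
  obtain ⟨U, hU, hUu, hw⟩ := hu.weak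
  have hδ := rate_pos (Cp := Cp) hε hMN
  have hcoer := fun t ht => rate_mul_le_aForm hX hε hCp hM hMN (hUu t ht).1
  set δ := rate Cp ε M
  set A := (hVec M).comp (toH1L X) with hA
  have hUd : ∀ t ∈ Ioo 0 T, HasDerivAt (fun t => hNorm M (u t) ^ 2)
      (2 * inner ℝ (A (U t)) (A (deriv U t))) t := by
    intro t ht
    have h1 : HasDerivAt U (deriv U t) t :=
      ((hU.differentiableOn one_ne_zero).differentiableAt (isOpen_Ioo.mem_nhds ht)).hasDerivAt
    refine (A.hasFDerivAt.comp_hasDerivAt t h1).norm_sq.congr_of_eventuallyEq ?_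
    filter_upwards [isOpen_Ioo.mem_nhds ht] with s hs
    rw [hNorm_eq_norm hM, ← (hUu s hs).2]
    rfl
  have hcont : ContinuousOn (fun t => hNorm M (u t) ^ 2) (Icc 0 T) := by
    simp only [hNorm_eq_norm hM]
    exact (hu.continuousOn_hVec hM).norm.pow 2
  have hfin := le_of_deriv_le (K := supNorm T M f ^ 2) hδ hcont hUd (fun t ht => by
    have h1 := IsSolution.weak_forall hM hf hU (hw (U t) (hUu t ht).1) t ht
    have h2 := hcoer t ht
    have h3 : hNorm M (f t) ≤ supNorm T M f := le_csSup hf_bdd ⟨t, ht, rfl⟩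
    have h4 : 0 ≤ hNorm M (f t) := Real.sqrt_nonneg _
    have h5 := pow_le_pow_left₀ h4 h3 2
    have h6 := real_inner_le_norm (hVec M (f t)) (A (U t))
    have e1 : hInner M (deriv U t).toH1 (U t).toH1 = inner ℝ (A (U t)) (A (deriv U t)) := by
      rw [hInner_eq_inner hM, real_inner_comm]
      rfl
    have e2 : hInner M (f t) (U t).toH1 = inner ℝ (hVec M (f t)) (A (U t)) :=
      hInner_eq_inner hM _ _
    have e3 : ‖A (U t)‖ = hNorm M (u t) := by
      rw [hNorm_eq_norm hM, ← (hUu t ht).2]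
      rfl
    rw [e1, e2] at h1
    rw [(hUu t ht).2] at h2
    rw [e3, ← hNorm_eq_norm hM] at h6
    -- Young's inequality spends half of the dissipation `2δ‖u‖²` on the source; the other half
    -- gives the decay rate `δ`.
    have h7 : 2 * (hNorm M (f t) * hNorm M (u t)) ≤
        δ * hNorm M (u t) ^ 2 + hNorm M (f t) ^ 2 / δ := by
      have : δ * hNorm M (u t) ^ 2 + hNorm M (f t) ^ 2 / δ - 2 * (hNorm M (f t) * hNorm M (u t)) =
          (δ * hNorm M (u t) - hNorm M (f t)) ^ 2 / δ := by
        field_simp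
        ring
      have : 0 ≤ (δ * hNorm M (u t) - hNorm M (f t)) ^ 2 / δ := by positivity
      linarith
    have h8 := div_le_div_of_nonneg_right h5 hδ.le
    linarith) hτ
  rw [hu.init] at hfin
  exact hfin

lemma stabBound_le_max {δ T : ℝ} (hδ : 0 < δ) (M : Matrix (Fin 2) (Fin 2) ℝ) (f : ℝ → H1 X)
    (u₀ : H1 X) {τ : ℝ} (hτ : τ ∈ Icc 0 T) :
    stabBound δ T M f u₀ τ ≤ max (stabBound δ T M f u₀ 0) (stabBound δ T M f u₀ T) := by
  have h1 : Real.exp (-δ * τ) ≤ Real.exp (-δ * 0) := Real.exp_le_exp.2 (by nlinarith [hτ.1])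
  have h2 : Real.exp (-δ * T) ≤ Real.exp (-δ * τ) := Real.exp_le_exp.2 (by nlinarith [hτ.2])
  have key : ∀ s, stabBound δ T M f u₀ s = Real.exp (-δ * s) *
      (hNorm M u₀ ^ 2 - supNorm T M f ^ 2 / δ ^ 2) + supNorm T M f ^ 2 / δ ^ 2 := fun s => by
    unfold stabBound
    ring
  simp only [key]
  -- The sign of the coefficient of `e^{-δτ}` decides whether the bound decreases or increases in
  -- time, hence which endpoint dominates.
  rcases le_total 0 (hNorm M u₀ ^ 2 - supNorm T M f ^ 2 / δ ^ 2) with h | h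
  · exact le_max_of_le_left (by linarith [mul_le_mul_of_nonneg_right h1 h])
  · exact le_max_of_le_right (by linarith [mul_le_mul_of_nonpos_right h2 h])

end Kolmogorov

theorem mainTheorem2 (X T ε Cp : ℝ) (hX : 0 < X) (hT : 0 < T) (hε : 0 < ε)
    (M : Matrix (Fin 2) (Fin 2) ℝ) (hM : M.PosSemidef) (hM_entries : ∀ i j, 0 ≤ M i j)
    (hMN : M 1 1 ^ 2 < 4 * ε * M 0 1)
    (hCp : poincareConst X ≤ Cp)
    (f : ℝ → H1 X) (hf : ContinuousOn f (Set.Ioo 0 T))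
    (hf_bdd : BddAbove ((fun t => hNorm M (f t)) '' Set.Ioo 0 T))
    (u₀ : H1 X) (u : ℝ → H1 X) (hu : IsSolution T ε M f u₀ u) :
    ∀ τ ∈ Set.Icc 0 T,
      hNorm M (u τ) ^ 2 ≤ stabBound (rate Cp ε M) T M f u₀ τ ∧
      stabBound (rate Cp ε M) T M f u₀ τ ≤
        max (stabBound (rate Cp ε M) T M f u₀ 0) (stabBound (rate Cp ε M) T M f u₀ T) ∧
      hNorm M (u τ) ^ 2 ≤
        max (stabBound (rate Cp ε M) T M f u₀ 0) (stabBound (rate Cp ε M) T M f u₀ T) := by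
  intro τ hτ
  have h1 := hu.hNorm_sq_le hX hε hCp hM hMN hf hf_bdd hτ
  have h2 := stabBound_le_max (rate_pos (Cp := Cp) hε hMN) M f u₀ hτ
  exact ⟨h1, h2, h1.trans h2⟩
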